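/- Work in Krivine's $\lambda_c$-calculus: closed terms built from variables, application, abstraction, $\mathsf{cc}$, continuation constants $k_\pi$, nonrestricted instructions $\eta_i$ and restricted instructions $\rho_i$ ($i\in\mathbb N$); stacks $\pi ::= \varepsilon_i \mid t\cdot\pi$ ($t$ closed, $i\in\mathbb N$); processes $t\star\pi$; and evaluation $\succ$, the least preorder on processes with $tu\star\pi\succ t\star u\cdot\pi$, $\lambda x.t\star u\cdot\pi\succ t[x:=u]\star\pi$, $\mathsf{cc}\star t\cdot\pi\succ t\star k_\pi\cdot\pi$, $k_{\pi'}\star t\cdot\pi\succ t\star\pi'$. A pole is a set $\bot\!\!\!\bot$ of processes such that $p\succ q\in\bot\!\!\!\bot$ implies $p\in\bot\!\!\!\bot$. Formulas are those of second-order logic whose first-order terms are built from all functions $\mathbb N^k\to\mathbb N$, with the additional constructions $(a=b)\mapsto A$, $A\cap B$, $A\cup B$ and parameters $F:\mathbb N^k\to\mathcal P(\Pi)$, where $\Pi$ is the set of stacks. For a pole $\bot\!\!\!\bot$, the falsity value $\|A\|\subseteq\Pi$ of a closed formula is given by: $\|\top\|=\emptyset$; $\|\bot\|=\Pi$; $\|A\to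 B\|=\{t\cdot\pi : t\in|A|,\ \pi\in\|B\|\}$; $\|\forall x\,A\|=\bigcup_{n\in\mathbb N}\|A[x:=n]\|$; $\|\forall X\,A\|=\bigcup_{F:\mathbb N^k\to\mathcal P(\Pi)}\|A[X:=F]\|$ ($X$ of arity $k$); $\|(a=b)\mapsto A\|=\|A\|$ if $a,b$ have the same value, and $\emptyset$ otherwise; $\|A\cap B\|=\|A\|\cup\|B\|$; $\|A\cup B\|=\|A\|\cap\|B\|$; $\|F(a_1,\dots,a_k)\|=F(v_1,\dots,v_k)$, where $v_i$ is the value of $a_i$. Here $|A|$ is the set of closed terms $t$ such that $t\star\pi\in\bot\!\!\!\bot$ for all $\pi\in\|A\|$; its elements are said to realize $A$. A term realizes $A$ universally if it realizes $A$ for every pole. A term is proof-like if it contains no $k_\pi$ and no restricted instruction. Two closed formulas $A,B$ are universally equivalent if some proof-like term universally realizes $(A\to B)\wedge(B\to A)$. The connectives $\wedge,\vee,=$ have their usual second-order encodings, and $a\neq b$ means $(a=b)\mapsto\bot$. For a formula $A$ of the language of Boolean algebras, $\gimel 2\models A$ is $A$ with each quantifier $\forall x\,B$ replaced by $\forall x\,\big((\min(x+1,2)=x+1)\mapsto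 B\big)$, where $0$, $1$, $\vee$, $\wedge$, $\neg$ are read as functions on $\mathbb N$: $m\vee n$ is $1$ if $m>0$ or $n>0$, and $0$ otherwise; $m\wedge n$ is $1$ if $m>0$ and $n>0$, and $0$ otherwise; $\neg m$ is $1$ if $m=0$, and $0$ otherwise. For a positive integer $k$, let $|\gimel 2|<k$ be the formula $\gimel 2\models\forall x_1\dots x_k\ \bigvee_{i\ne j}(x_i=x_j)$. Let $A_n$ be $\forall x_1\dots x_n\ \big(x_1\neq0\to\dots\to x_n\neq0\to(\bigvee_{i\neq j}x_i\wedge x_j)\neq0\big)$ (the empty join is $0$), and let $\mathrm{nondet}_n$ be $\forall X\ \bigcap_{i=1}^n(B_{i,1}\to\dots\to B_{i,n}\to X)$, where $X$ has arity $0$, $B_{i,i}=\top$ and $B_{i,j}=X$ for $j\ne i$. **Proposition.** Let $n$ be a positive integer. The three formulas $|\gimel 2|<2^n$, $\gimel 2\models A_n$ and $\mathrm{nondet}_n$ are pairwise universally equivalent. Moreover $\mathrm{nondet}_n\to(\gimel 2\models A_n)$ is universally realized by the proof-like term $\lambda t.\,t$, and $(\gimel 2\models A_n)\to\mathrm{nondet}_n$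 is universally realized by the proof-like term $\lambda t.\lambda u_1.\cdots\lambda u_n.\ \mathsf{cc}\,(\lambda k.\ t\,(k\,u_1)\cdots(k\,u_n))$. -/

import Mathlib

namespace ClassicalRealizability

/-! ### The `λ_c`-calculus

Terms modulo `α`-equivalence are represented by well-scoped de Bruijn terms. -/

mutual
/-- `LTerm n`: the `λ_c`-terms whose free variables are among `n` given ones
(variable `0` is the one bound most recently). -/
inductive LTerm : ℕ → Type
  | var {n : ℕ} (i : Fin n) : LTerm n
  | app {n : ℕ} (t u : LTerm n) : LTerm n
  | lam {n : ℕ} (t : LTerm (n + 1)) : LTerm n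
  /-- call-with-current-continuation -/
  | cc {n : ℕ} : LTerm n
  /-- the continuation constant `k_π` -/
  | cont {n : ℕ} (π : Stack) : LTerm n
  /-- nonrestricted instructions -/
  | instr {n : ℕ} (i : ℕ) : LTerm n
  /-- restricted instructions -/
  | rinstr {n : ℕ} (i : ℕ) : LTerm n
/-- Stacks: lists of closed terms that end in a stack bottom. -/
inductive Stack : Type
  | bottom (i : ℕ) : Stack
  | push (t : LTerm 0) (π : Stack) : Stack
end

/-- Terms (without further precision) are closed `λ_c`-terms. -/
abbrev Term : Type := LTerm 0

namespace LTerm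

/-- Renaming of free variables. -/
def rename : {n m : ℕ} → (Fin n → Fin m) → LTerm n → LTerm m
  | _, _, r, var i => var (r i)
  | _, _, r, app t u => app (rename r t) (rename r u)
  | _, _, r, lam t => lam (rename (Fin.cons 0 (fun i => (r i).succ)) t)
  | _, _, _, cc => cc
  | _, _, _, cont π => cont π
  | _, _, _, instr i => instr i
  | _, _, _, rinstr i => rinstr i

/-- Simultaneous capture-avoiding substitution. -/
def subst : {n m : ℕ} → (Fin n → LTerm m) → LTerm n → LTerm m
  | _, _, s, var i => s i
  | _, _, s, app t u => app (subst s t) (subst s u)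
  | _, _, s, lam t => lam (subst (Fin.cons (var 0) (fun i => rename Fin.succ (s i))) t)
  | _, _, _, cc => cc
  | _, _, _, cont π => cont π
  | _, _, _, instr i => instr i
  | _, _, _, rinstr i => rinstr i

/-- `t[x := u]` where `x` is the only free variable of `t` and `u` is closed. -/
def inst (t : LTerm 1) (u : Term) : Term := subst (fun _ => u) t

/-- Neither continuation constants nor restricted instructions occur. -/
def ProofLike : {n : ℕ} → LTerm n → Prop
  | _, var _ => True
  | _, app t u => ProofLike t ∧ ProofLike u
  | _, lam t => ProofLike t
  | _, cc => True
  | _, cont _ => False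
  | _, instr _ => True
  | _, rinstr _ => False

/-- `λ x₁. … λ xₙ. t`. -/
def lams : (n : ℕ) → LTerm n → Term
  | 0, t => t
  | n + 1, t => lams n (lam t)

/-- `t u₁ … u_r`. -/
def apps {n : ℕ} (t : LTerm n) (us : List (LTerm n)) : LTerm n := us.foldl app t

end LTerm

/-- A process `t ⋆ π`. -/
structure Proc : Type where
  head : Term
  stack : Stack

/-- One-step evaluation. -/
inductive Step : Proc → Proc → Prop
  | push (t u : Term) (π : Stack) : Step ⟨LTerm.app t u, π⟩ ⟨t, Stack.push u π⟩
  | grab (t : LTerm 1) (u : Term) (π : Stack) :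
      Step ⟨LTerm.lam t, Stack.push u π⟩ ⟨t.inst u, π⟩
  | save (t : Term) (π : Stack) :
      Step ⟨LTerm.cc, Stack.push t π⟩ ⟨t, Stack.push (LTerm.cont π) π⟩
  | restore (t : Term) (π π' : Stack) :
      Step ⟨LTerm.cont π', Stack.push t π⟩ ⟨t, π'⟩

/-- Evaluation: the smallest preorder that contains one-step evaluation. -/
def Eval : Proc → Proc → Prop := Relation.ReflTransGen Step

/-- A pole: a set of processes closed by anti-evaluation. -/
structure Pole : Type where
  carrier : Set Proc
  antiEval : ∀ p q : Proc, Eval p q → q ∈ carrier → p ∈ carrier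

/-- The dual of a set of stacks with respect to a pole. -/
def Pole.dual (P : Pole) (X : Set Stack) : Set Term :=
  {t | ∀ π ∈ X, (⟨t, π⟩ : Proc) ∈ P.carrier}

/-! ### The realizability language -/

/-- First-order terms whose free variables are among `m` given ones; every function
`ℕᵏ → ℕ` is a function symbol. -/
inductive FTerm (m : ℕ) : Type
  | var (i : Fin m) : FTerm m
  | app {k : ℕ} (f : (Fin k → ℕ) → ℕ) (args : Fin k → FTerm m) : FTerm m

namespace FTerm

/-- The value of a first-order term under a valuation of its free variables. -/
def val {m : ℕ} (ρ : Fin m → ℕ) : FTerm m → ℕ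
  | var i => ρ i
  | app f args => f (fun i => val ρ (args i))

/-- The numeral `k`, a function symbol without arguments. -/
def num {m : ℕ} (k : ℕ) : FTerm m := app (fun _ : Fin 0 → ℕ => k) ![]

/-- Application of a unary function symbol. -/
def app₁ {m : ℕ} (f : ℕ → ℕ) (a : FTerm m) : FTerm m :=
  app (fun v : Fin 1 → ℕ => f (v 0)) ![a]

/-- Application of a binary function symbol. -/
def app₂ {m : ℕ} (f : ℕ → ℕ → ℕ) (a b : FTerm m) : FTerm m :=
  app (fun v : Fin 2 → ℕ => f (v 0) (v 1)) ![a, b]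

end FTerm

/-- `SOVar Γ k`: the `k`-ary second-order (propositional) variables of a second-order
context `Γ`, which is the list of the arities of the variables in scope. -/
inductive SOVar : List ℕ → ℕ → Type
  | zero {Γ : List ℕ} {k : ℕ} : SOVar (k :: Γ) k
  | succ {Γ : List ℕ} {j k : ℕ} (X : SOVar Γ k) : SOVar (j :: Γ) k

/-- Lifting of a renaming of second-order variables under a binder. -/
def SOVar.lift {Γ Δ : List ℕ} (j : ℕ) (r : ∀ k, SOVar Γ k → SOVar Δ k) :
    ∀ k, SOVar (j :: Γ) k → SOVar (j :: Δ) k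
  | _, SOVar.zero => SOVar.zero
  | k, SOVar.succ X => SOVar.succ (r k X)

/-- Formulas, modulo `α`-equivalence, whose free second-order variables are those of `Γ` and
whose free first-order variables are among `m` given ones. -/
inductive Formula : List ℕ → ℕ → Type
  /-- `X(a₁, …, a_k)` -/
  | rel {Γ : List ℕ} {m k : ℕ} (X : SOVar Γ k) (args : Fin k → FTerm m) : Formula Γ m
  | top {Γ : List ℕ} {m : ℕ} : Formula Γ m
  | bot {Γ : List ℕ} {m : ℕ} : Formula Γ m
  | imp {Γ : List ℕ} {m : ℕ} (A B : Formula Γ m) : Formula Γ m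
  /-- first-order quantification -/
  | all₁ {Γ : List ℕ} {m : ℕ} (A : Formula Γ (m + 1)) : Formula Γ m
  /-- quantification over a `k`-ary second-order variable -/
  | all₂ {Γ : List ℕ} {m : ℕ} (k : ℕ) (A : Formula (k :: Γ) m) : Formula Γ m
  /-- equational implication `(a = b) ↦ A` -/
  | eqImp {Γ : List ℕ} {m : ℕ} (a b : FTerm m) (A : Formula Γ m) : Formula Γ m
  /-- `A ∩ B` -/
  | inter {Γ : List ℕ} {m : ℕ} (A B : Formula Γ m) : Formula Γ m
  /-- `A ∪ B` -/
  | union {Γ : List ℕ} {m : ℕ} (A B : Formula Γ m) : Formula Γ m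
  /-- a parameter `F : ℕᵏ → 𝒫(Π)` applied to first-order terms -/
  | param {Γ : List ℕ} {m k : ℕ} (F : (Fin k → ℕ) → Set Stack) (args : Fin k → FTerm m) :
      Formula Γ m

/-- Closed formulas. -/
abbrev Sentence : Type := Formula [] 0

/-- Valuations of the second-order variables of `Γ` by parameters. -/
abbrev SOVal (Γ : List ℕ) : Type := ∀ k, SOVar Γ k → (Fin k → ℕ) → Set Stack

/-- The valuation of the empty second-order context. -/
def SOVal.nil : SOVal [] := fun _ X => nomatch X

/-- Extension of a second-order valuation by a value for one more variable. -/
def SOVal.cons {Γ : List ℕ} {j : ℕ} (F : (Fin j → ℕ) → Set Stack) (σ : SOVal Γ) :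
    SOVal (j :: Γ)
  | _, SOVar.zero => F
  | k, SOVar.succ X => σ k X

namespace Formula

/-- Renaming of second-order variables. -/
def rename : {Γ Δ : List ℕ} → {m : ℕ} → (∀ k, SOVar Γ k → SOVar Δ k) →
    Formula Γ m → Formula Δ m
  | _, _, _, r, rel X args => rel (r _ X) args
  | _, _, _, _, top => top
  | _, _, _, _, bot => bot
  | _, _, _, r, imp A B => imp (rename r A) (rename r B)
  | _, _, _, r, all₁ A => all₁ (rename r A)
  | _, _, _, r, all₂ k A => all₂ k (rename (SOVar.lift k r) A)
  | _, _, _, r, eqImp a b A => eqImp a b (rename r A)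
  | _, _, _, r, inter A B => inter (rename r A) (rename r B)
  | _, _, _, r, union A B => union (rename r A) (rename r B)
  | _, _, _, _, param F args => param F args

/-- `A`, seen in the scope of one more second-order variable that it does not mention. -/
def weaken {Γ : List ℕ} {m : ℕ} (k : ℕ) (A : Formula Γ m) : Formula (k :: Γ) m :=
  rename (fun _ X => SOVar.succ X) A

/-- The falsity value of a formula, its free variables being replaced by the integers and
parameters that the valuations `ρ` and `σ` give. -/
def falsity (P : Pole) : {Γ : List ℕ} → {m : ℕ} → Formula Γ m → (Fin m → ℕ) → SOVal Γ → Set Stack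
  | _, _, rel X args, ρ, σ => σ _ X (fun i => (args i).val ρ)
  | _, _, top, _, _ => ∅
  | _, _, bot, _, _ => Set.univ
  | _, _, imp A B, ρ, σ =>
      {π | ∃ t ∈ P.dual (falsity P A ρ σ), ∃ π' ∈ falsity P B ρ σ, π = Stack.push t π'}
  | _, _, all₁ A, ρ, σ => ⋃ n : ℕ, falsity P A (Fin.cons n ρ) σ
  | _, _, all₂ k A, ρ, σ => ⋃ F : (Fin k → ℕ) → Set Stack, falsity P A ρ (SOVal.cons F σ)
  | _, _, eqImp a b A, ρ, σ => {π | a.val ρ = b.val ρ ∧ π ∈ falsity P A ρ σ}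
  | _, _, inter A B, ρ, σ => falsity P A ρ σ ∪ falsity P B ρ σ
  | _, _, union A B, ρ, σ => falsity P A ρ σ ∩ falsity P B ρ σ
  | _, _, param F args, ρ, _ => F (fun i => (args i).val ρ)

/-- Equality `a = b`: `∀ Z, Z(a) → Z(b)`. -/
def eq {Γ : List ℕ} {m : ℕ} (a b : FTerm m) : Formula Γ m :=
  all₂ 1 (imp (rel SOVar.zero ![a]) (rel SOVar.zero ![b]))

/-- `a ≠ b`: `(a = b) ↦ ⊥`. -/
def ne {Γ : List ℕ} {m : ℕ} (a b : FTerm m) : Formula Γ m := eqImp a b bot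

/-- Conjunction: `∀ Z, (A → B → Z) → Z`. -/
def and {Γ : List ℕ} {m : ℕ} (A B : Formula Γ m) : Formula Γ m :=
  all₂ 0 (imp (imp (A.weaken 0) (imp (B.weaken 0) (rel SOVar.zero ![]))) (rel SOVar.zero ![]))

/-- Disjunction: `∀ Z, (A → Z) → (B → Z) → Z`. -/
def or {Γ : List ℕ} {m : ℕ} (A B : Formula Γ m) : Formula Γ m :=
  all₂ 0 (imp (imp (A.weaken 0) (rel SOVar.zero ![]))
    (imp (imp (B.weaken 0) (rel SOVar.zero ![])) (rel SOVar.zero ![])))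

/-- Equivalence: `(A → B) ∧ (B → A)`. -/
def iff {Γ : List ℕ} {m : ℕ} (A B : Formula Γ m) : Formula Γ m := and (imp A B) (imp B A)

/-- `A₁ → … → A_r → B`. -/
def arrows {Γ : List ℕ} {m : ℕ} (As : List (Formula Γ m)) (B : Formula Γ m) : Formula Γ m :=
  As.foldr imp B

/-- `A₁ ∩ … ∩ A_r`. -/
def bigInter {Γ : List ℕ} {m : ℕ} : List (Formula Γ m) → Formula Γ m
  | [] => top
  | A :: As => As.foldl inter A

/-- Universal quantification over all free first-order variables. -/
def close₁ {Γ : List ℕ} : {m : ℕ} → Formula Γ m → Formula Γ 0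
  | 0, A => A
  | _ + 1, A => close₁ (all₁ A)

/-- Universal quantification over all free second-order variables. -/
def close₂ : {Γ : List ℕ} → Formula Γ 0 → Sentence
  | [], A => A
  | k :: _, A => close₂ (all₂ k A)

/-- The universal closure `∀ X₁ … X_p ∀ y₁ … y_m, A`. -/
def close {Γ : List ℕ} {m : ℕ} (A : Formula Γ m) : Sentence := close₂ (close₁ A)

end Formula

/-- The falsity value of a closed formula. -/
def Sentence.falsity (P : Pole) (A : Sentence) : Set Stack :=
  Formula.falsity P A Fin.elim0 SOVal.nil

/-- The term `t` realizes the closed formula `A` with respect to the pole `P`, that is, `t`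
belongs to the truth value of `A`. -/
def Realizes (P : Pole) (t : Term) (A : Sentence) : Prop := t ∈ P.dual (Sentence.falsity P A)

/-- `t` realizes `A` with respect to every pole. -/
def RealizesUniversally (t : Term) (A : Sentence) : Prop := ∀ P : Pole, Realizes P t A

/-- `A` is universally realized by a proof-like term. -/
def UniversallyRealized (A : Sentence) : Prop :=
  ∃ t : Term, t.ProofLike ∧ RealizesUniversally t A

/-- Universal equivalence: the universal closure of `A ↔ B` is universally realized by a
proof-like term. -/
def UniversallyEquivalent {Γ : List ℕ} {m : ℕ} (A B : Formula Γ m) : Prop :=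
  UniversallyRealized (Formula.close (Formula.iff A B))

/-! ### The characteristic Boolean algebra `ℷ2` -/

/-- The relativized quantifier `∀ x^{ℷk} A`, that is, `∀ x, (x + 1 ≤ k) ↦ A`, where `a ≤ b`
stands for the equation `min(a, b) = a`. -/
def Formula.allGim {Γ : List ℕ} {m : ℕ} (k : ℕ) (A : Formula Γ (m + 1)) : Formula Γ m :=
  Formula.all₁ (Formula.eqImp
    (FTerm.app₂ min (FTerm.app₂ (· + ·) (FTerm.var 0) (FTerm.num 1)) (FTerm.num k))
    (FTerm.app₂ (· + ·) (FTerm.var 0) (FTerm.num 1)) A)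

/-- Terms of the language of Boolean algebras. -/
inductive BATerm (m : ℕ) : Type
  | var (i : Fin m) : BATerm m
  | zero : BATerm m
  | one : BATerm m
  | sup (a b : BATerm m) : BATerm m
  | inf (a b : BATerm m) : BATerm m
  | compl (a : BATerm m) : BATerm m

/-- Formulas of the language of Boolean algebras. -/
inductive BAFormula : ℕ → Type
  | top {m : ℕ} : BAFormula m
  | bot {m : ℕ} : BAFormula m
  | ne {m : ℕ} (a b : BATerm m) : BAFormula m
  | eq {m : ℕ} (a b : BATerm m) : BAFormula m
  | imp {m : ℕ} (A B : BAFormula m) : BAFormula m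
  | or {m : ℕ} (A B : BAFormula m) : BAFormula m
  | and {m : ℕ} (A B : BAFormula m) : BAFormula m
  | all {m : ℕ} (A : BAFormula (m + 1)) : BAFormula m

/-- The join on natural numbers: `1` if one of the arguments is positive, `0` otherwise. -/
def natSup (a b : ℕ) : ℕ := if 0 < a ∨ 0 < b then 1 else 0

/-- The meet on natural numbers: `1` if both arguments are positive, `0` otherwise. -/
def natInf (a b : ℕ) : ℕ := if 0 < a ∧ 0 < b then 1 else 0

/-- The complement on natural numbers: `1` if the argument is `0`, `0` otherwise. -/
def natCompl (a : ℕ) : ℕ := if a = 0 then 1 else 0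

namespace BATerm

/-- A term of the language of Boolean algebras as a first-order term. -/
def toFTerm {m : ℕ} : BATerm m → FTerm m
  | var i => FTerm.var i
  | zero => FTerm.num 0
  | one => FTerm.num 1
  | sup a b => FTerm.app₂ natSup a.toFTerm b.toFTerm
  | inf a b => FTerm.app₂ natInf a.toFTerm b.toFTerm
  | compl a => FTerm.app₁ natCompl a.toFTerm

/-- `a₁ ∨ … ∨ a_r`; the empty join is `0`. -/
def bigSup {m : ℕ} : List (BATerm m) → BATerm m
  | [] => zero
  | a :: as => as.foldl sup a

end BATerm

namespace BAFormula

/-- `ℷ2 ⊨ A`: the formula `A` with all its quantifiers relativized to `ℷ2`. -/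
def gim2 {Γ : List ℕ} : {m : ℕ} → BAFormula m → Formula Γ m
  | _, top => Formula.top
  | _, bot => Formula.bot
  | _, ne a b => Formula.ne a.toFTerm b.toFTerm
  | _, eq a b => Formula.eq a.toFTerm b.toFTerm
  | _, imp A B => Formula.imp A.gim2 B.gim2
  | _, or A B => Formula.or A.gim2 B.gim2
  | _, and A B => Formula.and A.gim2 B.gim2
  | _, all A => Formula.allGim 2 A.gim2

/-- `A₁ ∨ … ∨ A_r`; the empty disjunction is `⊥`. -/
def bigOr {m : ℕ} : List (BAFormula m) → BAFormula m
  | [] => bot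
  | A :: As => As.foldl or A

/-- `A₁ → … → A_r → B`. -/
def arrows {m : ℕ} (As : List (BAFormula m)) (B : BAFormula m) : BAFormula m := As.foldr imp B

/-- `∀ x₁ … x_n, A`. -/
def alls : (n : ℕ) → BAFormula n → BAFormula 0
  | 0, A => A
  | n + 1, A => alls n (all A)

end BAFormula

/-- The variable `x_{i+1}` in the scope of `∀ x₁ … x_n` (de Bruijn indices count binders from the
innermost one). -/
def bvar {n : ℕ} (i : Fin n) : BATerm n := BATerm.var i.rev

/-- The pairs `(i, j)` of indices with `i ≠ j`, in lexicographic order. -/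
def distinctPairs (n : ℕ) : List (Fin n × Fin n) :=
  (List.product (List.finRange n) (List.finRange n)).filter (fun p => p.1 ≠ p.2)

/-- The formula `|ℷ2| < k`: `ℷ2 ⊨ ∀ x₁ … x_k, ⋁_{i ≠ j} x_i = x_j`. -/
def gimLt (k : ℕ) : Sentence :=
  BAFormula.gim2 (BAFormula.alls k (BAFormula.bigOr
    ((distinctPairs k).map fun p => BAFormula.eq (bvar p.1) (bvar p.2))))

/-- The formula `A_n` of the language of Boolean algebras:
`∀ x₁ … x_n, x₁ ≠ 0 → … → x_n ≠ 0 → (⋁_{i ≠ j} x_i ∧ x_j) ≠ 0`. -/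
def boolNoDisjoint (n : ℕ) : BAFormula 0 :=
  BAFormula.alls n (BAFormula.arrows
    ((List.finRange n).map fun i => BAFormula.ne (bvar i) BATerm.zero)
    (BAFormula.ne
      (BATerm.bigSup ((distinctPairs n).map fun p => BATerm.inf (bvar p.1) (bvar p.2)))
      BATerm.zero))

/-- The formula `nondet_n`: `∀ X, ⋂ᵢ (X → … → ⊤ → … → X → X)`, where the `i`-th of the `n`
premises is `⊤` and all the others are `X`. -/
def nondet (n : ℕ) : Sentence :=
  Formula.all₂ 0 (Formula.bigInter ((List.finRange n).map fun i =>
    Formula.arrows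
      ((List.finRange n).map fun j => if j = i then Formula.top else Formula.rel SOVar.zero ![])
      (Formula.rel SOVar.zero ![])))

/-- The term `λ t. t`. -/
def idTerm : Term := LTerm.lam (LTerm.var 0)

/-- The term `λ t. λ u₁. … λ u_n. cc (λ k. t (k u₁) … (k u_n))`. -/
def ccTerm (n : ℕ) : Term :=
  LTerm.lams (n + 1) (LTerm.app LTerm.cc (LTerm.lam (LTerm.apps (LTerm.var (Fin.last (n + 1)))
    ((List.finRange n).map fun i =>
      LTerm.app (LTerm.var 0) (LTerm.var i.rev.castSucc.succ)))))

end ClassicalRealizability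

open ClassicalRealizability

-- Everything passes through `nondet n`, whose falsity value consists of the stacks `u₁ · … · u_n ·
-- π'` with `π' ∈ X` and all but one of the `u_j` in `|X|`, for some `X`. For `A_n`, only
-- assignments of 0 and 1 in which at most one `x_i` is nonzero contribute, and this gives exactly
-- the case `X = Π`. Hence the identity goes from `nondet n` to `A_n`. Conversely, a captured
-- continuation `k_π` with `π ∈ X` turns each realizer `u_j` of `X` into a realizer `k_π u_j` of
-- `⊥`. From `nondet n` to `|ℷ2| < 2^n` (`exists_nondet_imp_gimLt_on`), a term is built by induction
-- on a set `T` of assignments `x : Fin k → Fin 2`, so that it realizes the disjunction at every `x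
-- ∈ T`. If `T` has fewer than `n` elements, the pigeonhole principle gives a single pair of indices
-- that works for all of `T`. Otherwise, delete in turn each of `n` chosen elements of `T`, and feed
-- the `n` resulting terms to the realizer of `nondet n`: at a given `x`, at most one of them fails.
-- From `|ℷ2| < 2^n` to `nondet n` (`exists_gimLt_imp_nondet`), the `2^n` variables are labelled by
-- the subsets of `Fin n`, and the variable labelled by `S` receives the truth value of `i ∈ S`,
-- where `i` is the unreliable position.

namespace ClassicalRealizability

-- Renaming, substitution and proof-like terms

namespace LTerm

theorem cons_succ_comp {n m l : ℕ} (r : Fin n → Fin m) (r' : Fin m → Fin l) :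
    (fun i => (Fin.cons 0 (fun i => (r' i).succ) : Fin (m + 1) → Fin (l + 1))
      ((Fin.cons 0 (fun i => (r i).succ) : Fin (n + 1) → Fin (m + 1)) i)) =
      Fin.cons 0 (fun i => (r' (r i)).succ) := by
  funext i
  refine Fin.cases ?_ (fun i => ?_) i <;> simp

theorem rename_rename : ∀ {n m l : ℕ} (r : Fin n → Fin m) (r' : Fin m → Fin l) (t : LTerm n),
    rename r' (rename r t) = rename (fun i => r' (r i)) t
  | _, _, _, _, _, var _ => by simp [rename]
  | _, _, _, r, r', app t u => by
      simp [rename, rename_rename r r' t, rename_rename r r' u]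
  | _, _, _, r, r', lam t => by
      simp only [rename, rename_rename _ _ t, cons_succ_comp]
  | _, _, _, _, _, cc => by simp [rename]
  | _, _, _, _, _, cont _ => by simp [rename]
  | _, _, _, _, _, instr _ => by simp [rename]
  | _, _, _, _, _, rinstr _ => by simp [rename]

theorem subst_rename : ∀ {n m l : ℕ} (r : Fin n → Fin m) (s : Fin m → LTerm l) (t : LTerm n),
    subst s (rename r t) = subst (fun i => s (r i)) t
  | _, _, _, _, _, var _ => by simp [rename, subst]
  | _, _, _, r, s, app t u => by
      simp [rename, subst, subst_rename r s t, subst_rename r s u]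
  | _, _, _, r, s, lam t => by
      simp only [rename, subst, subst_rename _ _ t]
      congr 2
      funext i
      refine Fin.cases ?_ (fun i => ?_) i <;> simp
  | _, _, _, _, _, cc => by simp [rename, subst]
  | _, _, _, _, _, cont _ => by simp [rename, subst]
  | _, _, _, _, _, instr _ => by simp [rename, subst]
  | _, _, _, _, _, rinstr _ => by simp [rename, subst]

theorem rename_subst : ∀ {n m l : ℕ} (s : Fin n → LTerm m) (r : Fin m → Fin l) (t : LTerm n),
    rename r (subst s t) = subst (fun i => rename r (s i)) t
  | _, _, _, _, _, var _ => by simp [subst]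
  | _, _, _, s, r, app t u => by
      simp [rename, subst, rename_subst s r t, rename_subst s r u]
  | _, _, _, s, r, lam t => by
      simp only [rename, subst, rename_subst _ _ t]
      congr 2
      funext i
      refine Fin.cases ?_ (fun i => ?_) i <;> simp [rename, rename_rename]
  | _, _, _, _, _, cc => by simp [rename, subst]
  | _, _, _, _, _, cont _ => by simp [rename, subst]
  | _, _, _, _, _, instr _ => by simp [rename, subst]
  | _, _, _, _, _, rinstr _ => by simp [rename, subst]

theorem subst_subst : ∀ {n m l : ℕ} (s : Fin n → LTerm m) (s' : Fin m → LTerm l) (t : LTerm n),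
    subst s' (subst s t) = subst (fun i => subst s' (s i)) t
  | _, _, _, _, _, var _ => by simp [subst]
  | _, _, _, s, s', app t u => by
      simp [subst, subst_subst s s' t, subst_subst s s' u]
  | _, _, _, s, s', lam t => by
      simp only [subst, subst_subst _ _ t]
      congr 2
      funext i
      refine Fin.cases ?_ (fun i => ?_) i <;> simp [subst, subst_rename, rename_subst]
  | _, _, _, _, _, cc => by simp [subst]
  | _, _, _, _, _, cont _ => by simp [subst]
  | _, _, _, _, _, instr _ => by simp [subst]
  | _, _, _, _, _, rinstr _ => by simp [subst]

theorem subst_var : ∀ {n : ℕ} (t : LTerm n), subst var t = t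
  | _, var _ => by simp [subst]
  | _, app t u => by simp [subst, subst_var t, subst_var u]
  | n, lam t => by
      have h : (Fin.cons (var 0) (fun i => rename Fin.succ (var i)) : Fin (n + 1) → LTerm (n + 1))
          = var := by
        funext i
        refine Fin.cases ?_ (fun i => ?_) i <;> simp [rename]
      simp only [subst, h, subst_var t]
  | _, cc => by simp [subst]
  | _, cont _ => by simp [subst]
  | _, instr _ => by simp [subst]
  | _, rinstr _ => by simp [subst]

theorem subst_closed (s : Fin 0 → Term) (t : Term) : subst s t = t := by
  rw [Subsingleton.elim s var, subst_var]

/-- A closed term in the scope of arbitrary variables. -/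
def lift (m : ℕ) (t : Term) : LTerm m := rename Fin.elim0 t

theorem subst_lift {m : ℕ} (s : Fin m → Term) (t : Term) : subst s (lift m t) = t := by
  rw [lift, subst_rename, subst_closed]

theorem subst_cons_rename_succ {m : ℕ} (s : Fin m → Term) (u : Term) (t : LTerm m) :
    subst (Fin.cons u s : Fin (m + 1) → Term) (rename Fin.succ t) = subst s t := by
  simp [subst_rename]

/-- A β-step merely extends the environment: since the values of `s` are closed, instantiating the
new variable leaves them unchanged. -/
theorem inst_subst {m : ℕ} (s : Fin m → Term) (u : Term) (t : LTerm (m + 1)) :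
    inst (subst (Fin.cons (var 0) (fun i => rename Fin.succ (s i))) t) u =
      subst (Fin.cons u s : Fin (m + 1) → Term) t := by
  rw [inst, subst_subst]
  congr 1
  funext i
  refine Fin.cases ?_ (fun i => ?_) i <;> simp [subst, subst_rename, subst_closed]

theorem ProofLike.rename : ∀ {n m : ℕ} (r : Fin n → Fin m) {t : LTerm n},
    t.ProofLike → (t.rename r).ProofLike
  | _, _, _, var _, _ => by simp [LTerm.rename, ProofLike]
  | _, _, r, app t u, h => by
      simp only [ProofLike, LTerm.rename] at h ⊢
      exact ⟨ProofLike.rename r h.1, ProofLike.rename r h.2⟩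
  | _, _, r, lam t, h => by
      simp only [ProofLike, LTerm.rename] at h ⊢
      exact ProofLike.rename _ h
  | _, _, _, cc, _ => by simp [LTerm.rename, ProofLike]
  | _, _, _, cont _, h => by simp [ProofLike] at h
  | _, _, _, instr _, _ => by simp [LTerm.rename, ProofLike]
  | _, _, _, rinstr _, h => by simp [ProofLike] at h

theorem ProofLike.lift {m : ℕ} {t : Term} (h : t.ProofLike) : (t.lift m).ProofLike :=
  ProofLike.rename _ h

theorem ProofLike.lams : ∀ {n : ℕ} {t : LTerm n}, t.ProofLike → (lams n t).ProofLike
  | 0, _, h => h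
  | n + 1, t, h => ProofLike.lams (n := n) (t := lam t) (by simpa [ProofLike] using h)

theorem ProofLike.apps {n : ℕ} {us : List (LTerm n)} : ∀ {t : LTerm n}, t.ProofLike →
    (∀ u ∈ us, u.ProofLike) → (apps t us).ProofLike := by
  induction us with
  | nil => intro t ht _; exact ht
  | cons u us ih =>
    intro t ht hu
    refine ih (t := app t u) ?_ fun v hv => hu v (by simp [hv])
    simp only [ProofLike]
    exact ⟨ht, hu u (by simp)⟩

theorem subst_apps {n m : ℕ} (s : Fin n → LTerm m) (us : List (LTerm n)) : ∀ t : LTerm n,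
    subst s (apps t us) = apps (subst s t) (us.map (subst s)) := by
  induction us with
  | nil => intro t; rfl
  | cons u us ih =>
    intro t
    have := ih (app t u)
    simpa [apps, subst] using this

end LTerm

-- Evaluation of iterated applications and abstractions

open LTerm

/-- `t₁ · … · t_r · π`. -/
def Stack.pushes (us : List Term) (π : Stack) : Stack := us.foldr Stack.push π

theorem Eval.head {p q r : Proc} (h : Step p q) (h' : Eval q r) : Eval p r :=
  Relation.ReflTransGen.head h h'

theorem eval_apps (us : List Term) (π : Stack) : ∀ t : Term,
    Eval ⟨apps t us, π⟩ ⟨t, Stack.pushes us π⟩ := by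
  induction us with
  | nil => intro t; exact Relation.ReflTransGen.refl
  | cons u us ih =>
    intro t
    exact (ih (app t u)).tail (Step.push _ _ _)

/-- The order is reversed because variable `0` belongs to the innermost abstraction, which consumes
the last argument. -/
theorem eval_lams : ∀ {n : ℕ} (t : LTerm n) (us : Fin n → Term) (π : Stack),
    Eval ⟨lams n t, Stack.pushes (List.ofFn us) π⟩ ⟨t.subst (fun i => us i.rev), π⟩
  | 0, t, us, π => by
      rw [subst_closed]
      exact Relation.ReflTransGen.refl
  | n + 1, t, us, π => by
      have h := eval_lams (lam t) (fun i => us i.castSucc) (Stack.push (us (Fin.last n)) π)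
      have e : Stack.pushes (List.ofFn us) π = Stack.pushes (List.ofFn fun i => us i.castSucc)
          (Stack.push (us (Fin.last n)) π) := by
        rw [List.ofFn_succ']
        simp [Stack.pushes]
      rw [e]
      refine h.tail ?_
      have h' := Step.grab (subst (Fin.cons (var 0)
        (fun i : Fin n => rename Fin.succ (us i.rev.castSucc))) t) (us (Fin.last n)) π
      rw [inst_subst] at h'
      have e' : (Fin.cons (us (Fin.last n)) (fun i : Fin n => us i.rev.castSucc) :
          Fin (n + 1) → Term) = fun i => us i.rev := by
        funext i
        refine Fin.cases ?_ (fun i => ?_) i <;> simp [Fin.rev_succ]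
      rw [e'] at h'
      simpa only [subst] using h'

-- Implication and disjunction on falsity values

namespace Pole

variable (P : Pole)

theorem dual_anti {X Y : Set Stack} (h : X ⊆ Y) : P.dual Y ⊆ P.dual X :=
  fun _ ht π hπ => ht π (h hπ)

variable {P} in
theorem mem_dual_iUnion {ι : Type*} {X : ι → Set Stack} {t : Term} :
    t ∈ P.dual (⋃ i, X i) ↔ ∀ i, t ∈ P.dual (X i) := by
  simp only [dual, Set.mem_ofPred_eq, Set.mem_iUnion]
  exact ⟨fun h i π hπ => h π ⟨i, hπ⟩, fun h π ⟨i, hπ⟩ => h i π hπ⟩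

/-- The falsity value of an implication. -/
def imp (X Y : Set Stack) : Set Stack :=
  {π | ∃ t ∈ P.dual X, ∃ π' ∈ Y, π = Stack.push t π'}

/-- The falsity value of a disjunction. -/
def or (X Y : Set Stack) : Set Stack :=
  ⋃ Z : Set Stack, P.imp (P.imp X Z) (P.imp (P.imp Y Z) Z)

variable {P}

theorem app_mem_dual {X Y : Set Stack} {t u : Term} (ht : t ∈ P.dual (P.imp X Y))
    (hu : u ∈ P.dual X) : app t u ∈ P.dual Y := fun π hπ =>
  P.antiEval _ _ (Relation.ReflTransGen.single (Step.push t u π)) (ht _ ⟨u, hu, π, hπ, rfl⟩)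

/-- Closure of the pole under anti-evaluation reduces the claim to the contracted term. The
environment `s` is kept explicit so that the rule can be iterated under nested abstractions. -/
theorem lam_mem_dual {m : ℕ} {s : Fin m → Term} {X Y : Set Stack} {t : LTerm (m + 1)}
    (h : ∀ u ∈ P.dual X, subst (Fin.cons u s : Fin (m + 1) → Term) t ∈ P.dual Y) :
    subst s (lam t) ∈ P.dual (P.imp X Y) := by
  rintro _ ⟨u, hu, π, hπ, rfl⟩
  refine P.antiEval _ _ (Relation.ReflTransGen.single ?_) (h u hu π hπ)
  rw [← inst_subst, subst]
  exact Step.grab _ _ _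

theorem lam_closed_mem_dual {X Y : Set Stack} {t : LTerm 1}
    (h : ∀ u ∈ P.dual X, subst (fun _ => u) t ∈ P.dual Y) :
    lam t ∈ P.dual (P.imp X Y) := by
  rintro _ ⟨u, hu, π, hπ, rfl⟩
  exact P.antiEval _ _ (Relation.ReflTransGen.single (Step.grab _ _ _)) (h u hu π hπ)

theorem or_elim {X Y Z : Set Stack} {t u v : Term} (ht : t ∈ P.dual (P.or X Y))
    (hu : u ∈ P.dual (P.imp X Z)) (hv : v ∈ P.dual (P.imp Y Z)) :
    app (app t u) v ∈ P.dual Z :=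
  app_mem_dual (app_mem_dual (P.dual_anti (Set.subset_iUnion _ Z) ht) hu) hv

end Pole

-- Proof-like terms for finite disjunctions

theorem idTerm_proofLike : idTerm.ProofLike := by
  simp [idTerm, ProofLike]

theorem idTerm_mem_dual {P : Pole} {X Y : Set Stack} (h : Y ⊆ X) :
    idTerm ∈ P.dual (P.imp X Y) :=
  Pole.lam_closed_mem_dual fun u hu => by simpa [subst] using P.dual_anti h hu

/-- The falsity value of a disjunction over a nonempty list. -/
def Pole.bigOr (P : Pole) {ι : Type*} (X : ι → Set Stack) (a : ι) (l : List ι) : Set Stack :=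
  (l.map X).foldl P.or (X a)

theorem Pole.bigOr_concat (P : Pole) {ι : Type*} (X : ι → Set Stack) (a b : ι) (l : List ι) :
    P.bigOr X a (l ++ [b]) = P.or (P.bigOr X a l) (X b) := by
  simp [Pole.bigOr]

/-- `λ x. λ f. λ g. f x`. -/
def inlTerm : Term := lam (lam (lam (app (var 1) (var 2))))

/-- `λ x. λ f. λ g. g x`. -/
def inrTerm : Term := lam (lam (lam (app (var 0) (var 2))))

theorem inlTerm_mem_dual (P : Pole) (X Y : Set Stack) :
    inlTerm ∈ P.dual (P.imp X (P.or X Y)) := by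
  rw [inlTerm, ← subst_closed Fin.elim0 (lam _)]
  refine Pole.lam_mem_dual fun x hx => ?_
  refine Pole.mem_dual_iUnion.2 fun Z => ?_
  refine Pole.lam_mem_dual fun f hf => Pole.lam_mem_dual fun g hg => ?_
  simp only [subst]
  exact Pole.app_mem_dual hf hx

theorem inrTerm_mem_dual (P : Pole) (X Y : Set Stack) :
    inrTerm ∈ P.dual (P.imp Y (P.or X Y)) := by
  rw [inrTerm, ← subst_closed Fin.elim0 (lam _)]
  refine Pole.lam_mem_dual fun x hx => ?_
  refine Pole.mem_dual_iUnion.2 fun Z => ?_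
  refine Pole.lam_mem_dual fun f hf => Pole.lam_mem_dual fun g hg => ?_
  simp only [subst]
  exact Pole.app_mem_dual hg hx

/-- `λ x. t (u x)`. -/
def compTerm (t u : Term) : Term := lam (app (t.lift 1) (app (u.lift 1) (var 0)))

theorem compTerm_mem_dual {P : Pole} {X Y Z : Set Stack} {t u : Term}
    (ht : t ∈ P.dual (P.imp Y Z)) (hu : u ∈ P.dual (P.imp X Y)) :
    compTerm t u ∈ P.dual (P.imp X Z) :=
  Pole.lam_closed_mem_dual fun v hv => by
    simpa only [subst, subst_lift] using Pole.app_mem_dual ht (Pole.app_mem_dual hu hv)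

theorem compTerm_proofLike {t u : Term} (ht : t.ProofLike) (hu : u.ProofLike) :
    (compTerm t u).ProofLike := by
  simp [compTerm, ProofLike, ht.lift, hu.lift]

/-- Disjunctions associate to the left, so the term is at most one right injection followed by left
injections. It is chosen before the pole and `X`, as universal realizability requires. -/
theorem exists_bigOr_intro {ι : Type*} (a : ι) (l : List ι) : ∀ b ∈ a :: l,
    ∃ t : Term, t.ProofLike ∧
      ∀ (P : Pole) (X : ι → Set Stack), t ∈ P.dual (P.imp (X b) (P.bigOr X a l)) := by
  induction l using List.reverseRecOn with
  | nil =>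
    intro b hb
    obtain rfl : b = a := by simpa using hb
    exact ⟨idTerm, idTerm_proofLike, fun P X => idTerm_mem_dual subset_rfl⟩
  | append_singleton l c ih =>
    intro b hb
    have hb' : b ∈ a :: l ∨ b = c := by simpa [or_assoc] using hb
    rcases hb' with hb' | rfl
    · obtain ⟨t, ht, h⟩ := ih b hb'
      refine ⟨compTerm inlTerm t,
        compTerm_proofLike (by simp [inlTerm, ProofLike]) ht, fun P X => ?_⟩
      rw [Pole.bigOr_concat]
      exact compTerm_mem_dual (inlTerm_mem_dual _ _ _) (h P X)
    · refine ⟨inrTerm, by simp [inrTerm, ProofLike], fun P X => ?_⟩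
      rw [Pole.bigOr_concat]
      exact inrTerm_mem_dual _ _ _

/-- Case analysis, by a term independent of the pole and of `X`. The scope `m` varies in the
induction because the left branch of the outermost disjunction is treated under a new abstraction.
-/
theorem exists_bigOr_elim {ι : Type*} (a : ι) (l : List ι) : ∀ {m : ℕ} (d : LTerm m)
    (h : ι → LTerm m), d.ProofLike → (∀ b, (h b).ProofLike) →
    ∃ t : LTerm m, t.ProofLike ∧
      ∀ (P : Pole) (X : ι → Set Stack) (Y : Set Stack) (s : Fin m → Term),
        subst s d ∈ P.dual (P.bigOr X a l) →
        (∀ b ∈ a :: l, subst s (h b) ∈ P.dual (P.imp (X b) Y)) → subst s t ∈ P.dual Y := by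
  induction l using List.reverseRecOn with
  | nil =>
    intro m d h hd hh
    refine ⟨app (h a) d, by simp [ProofLike, hd, hh], fun P X Y s hs hs' => ?_⟩
    simp only [subst]
    exact Pole.app_mem_dual (hs' a (by simp)) hs
  | append_singleton l c ih =>
    intro m d h hd hh
    obtain ⟨t, ht, hts⟩ := ih (m := m + 1) (var 0) (fun b => rename Fin.succ (h b))
      (by simp [ProofLike]) (fun b => (hh b).rename _)
    refine ⟨app (app d (lam t)) (h c), by simp [ProofLike, hd, hh, ht],
      fun P X Y s hs hs' => ?_⟩
    rw [Pole.bigOr_concat] at hs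
    simp only [subst]
    refine Pole.or_elim hs ?_ (hs' c (by simp))
    refine Pole.lam_mem_dual fun u hu => hts P X Y _ (by simpa [subst] using hu) fun b hb => ?_
    rw [subst_cons_rename_succ]
    refine hs' b ?_
    rw [← List.cons_append]
    exact List.mem_append_left _ hb

-- Falsity values of compound formulas

theorem SOVar.lift_cons {Γ Δ : List ℕ} {j : ℕ} (r : ∀ k, SOVar Γ k → SOVar Δ k)
    (F : (Fin j → ℕ) → Set Stack) (σ : SOVal Δ) :
    (fun k X => SOVal.cons F σ k (SOVar.lift j r k X)) =
      SOVal.cons F (fun k X => σ k (r k X)) := by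
  funext k X
  cases X <;> rfl

namespace Formula

theorem falsity_rename (P : Pole) {Γ : List ℕ} {m : ℕ} (A : Formula Γ m) :
    ∀ {Δ : List ℕ} (r : ∀ k, SOVar Γ k → SOVar Δ k) (ρ : Fin m → ℕ) (σ : SOVal Δ),
      falsity P (rename r A) ρ σ = falsity P A ρ (fun k X => σ k (r k X)) := by
  induction A with
  | rel X args => intros; rfl
  | top => intros; rfl
  | bot => intros; rfl
  | imp A B ihA ihB => intros; simp only [rename, falsity, ihA, ihB]
  | all₁ A ih => intros; simp only [rename, falsity, ih]
  | all₂ k A ih => intros; simp only [rename, falsity, ih, SOVar.lift_cons]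
  | eqImp a b A ih => intros; simp only [rename, falsity, ih]
  | inter A B ihA ihB => intros; simp only [rename, falsity, ihA, ihB]
  | union A B ihA ihB => intros; simp only [rename, falsity, ihA, ihB]
  | param F args => intros; rfl

theorem falsity_weaken (P : Pole) {Γ : List ℕ} {m k : ℕ} (A : Formula Γ m) (ρ : Fin m → ℕ)
    (F : (Fin k → ℕ) → Set Stack) (σ : SOVal Γ) :
    falsity P (A.weaken k) ρ (SOVal.cons F σ) = falsity P A ρ σ :=
  falsity_rename P A _ ρ _

theorem falsity_imp (P : Pole) {Γ : List ℕ} {m : ℕ} (A B : Formula Γ m) (ρ : Fin m → ℕ)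
    (σ : SOVal Γ) : falsity P (imp A B) ρ σ = P.imp (falsity P A ρ σ) (falsity P B ρ σ) := by
  simp only [falsity, Pole.imp]

theorem falsity_or (P : Pole) {Γ : List ℕ} {m : ℕ} (A B : Formula Γ m) (ρ : Fin m → ℕ)
    (σ : SOVal Γ) : falsity P (or A B) ρ σ = P.or (falsity P A ρ σ) (falsity P B ρ σ) := by
  -- `falsity.eq_6` is the clause for `all₂`; it alone is unfolded here, so that the implications
  -- are rewritten to `Pole.imp` and the weakenings disappear.
  simp only [or, falsity.eq_6, falsity_imp, falsity_weaken, Pole.or]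
  simp only [falsity, SOVal.cons]
  ext π
  simp only [Set.mem_iUnion]
  exact ⟨fun ⟨F, h⟩ => ⟨_, h⟩, fun ⟨Z, h⟩ => ⟨fun _ => Z, h⟩⟩

theorem falsity_eq (P : Pole) {Γ : List ℕ} {m : ℕ} (a b : FTerm m) (ρ : Fin m → ℕ)
    (σ : SOVal Γ) : falsity P (eq a b) ρ σ =
      ⋃ F : (Fin 1 → ℕ) → Set Stack, P.imp (F fun _ => a.val ρ) (F fun _ => b.val ρ) := by
  simp [eq, falsity, SOVal.cons, Pole.imp]

theorem falsity_arrows_ofFn (P : Pole) {Γ : List ℕ} {m : ℕ} (B : Formula Γ m) (ρ : Fin m → ℕ)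
    (σ : SOVal Γ) {π : Stack} : ∀ {n : ℕ} (f : Fin n → Formula Γ m),
    π ∈ falsity P (arrows (List.ofFn f) B) ρ σ ↔
      ∃ us : Fin n → Term, (∀ i, us i ∈ P.dual (falsity P (f i) ρ σ)) ∧
        ∃ π' ∈ falsity P B ρ σ, π = Stack.pushes (List.ofFn us) π' := by
  intro n
  induction n generalizing π with
  | zero => intro f; simp [arrows, Stack.pushes]
  | succ n ih =>
    intro f
    simp only [List.ofFn_succ, arrows, List.foldr_cons, falsity, Stack.pushes, Set.mem_ofPred_eq]
    constructor
    · rintro ⟨t, ht, π', hπ', rfl⟩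
      obtain ⟨us, hus, π'', h, rfl⟩ := (ih _).1 hπ'
      refine ⟨Fin.cons t us, fun i => ?_, π'', h, ?_⟩
      · refine Fin.cases ?_ (fun i => ?_) i
        · simpa using ht
        · simpa using hus i
      · simp [Stack.pushes]
    · rintro ⟨us, hus, π', h, rfl⟩
      exact ⟨us 0, hus 0, _, (ih _).2 ⟨fun i => us i.succ, fun i => hus _, π', h, rfl⟩, rfl⟩

theorem mem_falsity_foldl_inter (P : Pole) {Γ : List ℕ} {m : ℕ} (ρ : Fin m → ℕ) (σ : SOVal Γ)
    {π : Stack} (L : List (Formula Γ m)) : ∀ A : Formula Γ m,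
    π ∈ falsity P (L.foldl inter A) ρ σ ↔ ∃ B ∈ A :: L, π ∈ falsity P B ρ σ := by
  induction L with
  | nil => simp
  | cons C L ih => intro A; simp [ih, falsity, or_assoc]

theorem mem_falsity_bigInter (P : Pole) {Γ : List ℕ} {m : ℕ} (ρ : Fin m → ℕ) (σ : SOVal Γ)
    {π : Stack} : ∀ L : List (Formula Γ m),
    π ∈ falsity P (bigInter L) ρ σ ↔ ∃ B ∈ L, π ∈ falsity P B ρ σ
  | [] => by simp [bigInter, falsity]
  | A :: L => mem_falsity_foldl_inter P ρ σ L A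

end Formula

-- Falsity values of `nondet n` and `A_n`

theorem mem_falsity_nondet {P : Pole} {n : ℕ} {π : Stack} :
    π ∈ Sentence.falsity P (nondet n) ↔ ∃ X : Set Stack, ∃ i : Fin n, ∃ us : Fin n → Term,
      (∀ j, j ≠ i → us j ∈ P.dual X) ∧ ∃ π' ∈ X, π = Stack.pushes (List.ofFn us) π' := by
  simp only [Sentence.falsity, nondet, Formula.falsity.eq_6, Set.mem_iUnion,
    Formula.mem_falsity_bigInter, List.mem_map, List.mem_finRange, true_and,
    exists_exists_eq_and]
  simp only [← List.ofFn_eq_map, Formula.falsity_arrows_ofFn]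
  have key : ∀ (F : (Fin 0 → ℕ) → Set Stack) (i j : Fin n) (u : Term),
      u ∈ P.dual (Formula.falsity P (if j = i then Formula.top else
        Formula.rel SOVar.zero ![]) Fin.elim0 (SOVal.cons F SOVal.nil)) ↔
      (j ≠ i → u ∈ P.dual (F ![])) := by
    intro F i j u
    by_cases h : j = i
    · simp [h, Formula.falsity, Pole.dual]
    · simp only [h, if_false, Formula.falsity, SOVal.cons, ne_eq, not_false_eq_true, true_imp_iff]
      rw [Subsingleton.elim (fun i => FTerm.val Fin.elim0 (![] i)) ![]]
  simp only [key]
  simp only [Formula.falsity, SOVal.cons]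
  constructor
  · rintro ⟨F, i, us, h, π', hπ', rfl⟩
    rw [Subsingleton.elim (fun i => FTerm.val Fin.elim0 (![] i)) ![]] at hπ'
    exact ⟨_, i, us, h, π', hπ', rfl⟩
  · rintro ⟨X, i, us, h, π', hπ', rfl⟩
    exact ⟨fun _ => X, i, us, h, π', hπ', rfl⟩

namespace BAFormula

/-- The relativizing equation `min(x + 1, 2) = x + 1` means `x < 2`; all other integers contribute
the empty set. -/
theorem mem_falsity_gim2_alls {P : Pole} {π : Stack} : ∀ {n : ℕ} (A : BAFormula n),
    π ∈ Sentence.falsity P (alls n A).gim2 ↔ ∃ x : Fin n → Fin 2,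
      π ∈ Formula.falsity P (Γ := []) A.gim2 (fun i => x i) SOVal.nil
  | 0, A => by
      simp only [alls, Sentence.falsity]
      constructor
      · intro h
        refine ⟨Fin.elim0, ?_⟩
        rwa [Subsingleton.elim (fun i : Fin 0 => ((Fin.elim0 i : Fin 2) : ℕ)) Fin.elim0]
      · rintro ⟨x, h⟩
        rwa [Subsingleton.elim (fun i : Fin 0 => (x i : ℕ)) Fin.elim0] at h
  | n + 1, A => by
      have e : ∀ (k : Fin 2) (x : Fin n → Fin 2), (fun i => ((Fin.cons k x : Fin (n + 1) → Fin 2) i : ℕ))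
          = Fin.cons (k : ℕ) (fun i => (x i : ℕ)) := by
        intro k x
        funext i
        refine Fin.cases ?_ (fun i => ?_) i <;> simp
      rw [alls, mem_falsity_gim2_alls (all A)]
      simp only [gim2, Formula.allGim, Formula.falsity, Set.mem_iUnion, Set.mem_ofPred_eq,
        FTerm.app₂, FTerm.val, FTerm.num, Matrix.cons_val_zero, Matrix.cons_val_one, Fin.cons_zero]
      constructor
      · rintro ⟨x, k, hk, h⟩
        refine ⟨Fin.cons (⟨k, by omega⟩ : Fin 2) x, ?_⟩
        rwa [e]
      · rintro ⟨x, h⟩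
        refine ⟨Fin.tail x, x 0, by omega, ?_⟩
        rwa [← e, Fin.cons_self_tail]

theorem gim2_arrows {Γ : List ℕ} {m : ℕ} (L : List (BAFormula m)) (B : BAFormula m) :
    (arrows L B).gim2 (Γ := Γ) = Formula.arrows (L.map gim2) B.gim2 := by
  induction L with
  | nil => rfl
  | cons A L ih =>
    simp only [arrows, Formula.arrows, List.foldr_cons, List.map_cons, gim2] at ih ⊢
    rw [ih]

theorem falsity_gim2_bigOr (P : Pole) {Γ : List ℕ} {m : ℕ} (ρ : Fin m → ℕ) (σ : SOVal Γ)
    {ι : Type*} (f : ι → BAFormula m) (a : ι) (l : List ι) :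
    Formula.falsity P (bigOr ((a :: l).map f)).gim2 ρ σ =
      P.bigOr (fun i => Formula.falsity P (f i).gim2 ρ σ) a l := by
  induction l using List.reverseRecOn with
  | nil => rfl
  | append_singleton l b ih =>
    rw [Pole.bigOr_concat, ← ih]
    simp only [bigOr, List.map_cons, List.map_append, List.map_nil, List.foldl_append,
      List.foldl_cons, List.foldl_nil, gim2, Formula.falsity_or]

end BAFormula

theorem BATerm.val_foldl_sup_eq_zero {m : ℕ} (ρ : Fin m → ℕ) (L : List (BATerm m)) :
    ∀ a : BATerm m, (L.foldl sup a).toFTerm.val ρ = 0 ↔ ∀ b ∈ a :: L, b.toFTerm.val ρ = 0 := by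
  induction L with
  | nil => simp
  | cons c L ih =>
    intro a
    simp [ih, toFTerm, FTerm.app₂, FTerm.val, natSup, and_assoc]

theorem BATerm.val_bigSup_eq_zero {m : ℕ} (ρ : Fin m → ℕ) : ∀ L : List (BATerm m),
    (bigSup L).toFTerm.val ρ = 0 ↔ ∀ b ∈ L, b.toFTerm.val ρ = 0
  | [] => by simp [bigSup, toFTerm, FTerm.num, FTerm.val]
  | a :: L => val_foldl_sup_eq_zero ρ L a

theorem BATerm.val_bigSup_map_eq_zero {m : ℕ} (ρ : Fin m → ℕ) {ι : Type*} (f : ι → BATerm m)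
    (l : List ι) : (bigSup (l.map f)).toFTerm.val ρ = 0 ↔ ∀ i ∈ l, (f i).toFTerm.val ρ = 0 := by
  simp [val_bigSup_eq_zero]

theorem mem_distinctPairs {n : ℕ} {p : Fin n × Fin n} : p ∈ distinctPairs n ↔ p.1 ≠ p.2 := by
  cases p
  simp [distinctPairs]

/-- The conclusion has a nonempty falsity value only when the join vanishes, that is, when at most
one variable is nonzero; a premise `x_j ≠ 0` then constrains `u_j` exactly when `x_j = 0`. -/
theorem mem_falsity_boolNoDisjoint {P : Pole} {n : ℕ} (hn : 0 < n) {π : Stack} :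
    π ∈ Sentence.falsity P (boolNoDisjoint n).gim2 ↔ ∃ i : Fin n, ∃ us : Fin n → Term,
      (∀ j, j ≠ i → us j ∈ P.dual Set.univ) ∧ ∃ π', π = Stack.pushes (List.ofFn us) π' := by
  rw [boolNoDisjoint, BAFormula.mem_falsity_gim2_alls]
  simp only [BAFormula.gim2_arrows, ← List.ofFn_eq_map, List.map_ofFn,
    Formula.falsity_arrows_ofFn]
  simp only [Function.comp_apply, BAFormula.gim2, Formula.ne, Formula.falsity,
    BATerm.toFTerm, bvar, FTerm.val, FTerm.num, Set.mem_univ, and_true, Set.mem_ofPred_eq,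
    BATerm.val_bigSup_map_eq_zero, mem_distinctPairs, FTerm.app₂, natInf, Matrix.cons_val_zero,
    Matrix.cons_val_one, Prod.forall]
  have key : ∀ (k : ℕ) (u : Term), u ∈ P.dual {_π | k = 0} ↔ (k = 0 → u ∈ P.dual Set.univ) := by
    intro k u
    by_cases h : k = 0 <;> simp [h, Pole.dual]
  simp only [key]
  constructor
  · rintro ⟨x, us, hus, π', hx, rfl⟩
    by_cases h : ∃ i : Fin n, x i.rev ≠ 0
    · obtain ⟨i, hi⟩ := h
      refine ⟨i, us, fun j hj => hus j ?_, π', rfl⟩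
      have := hx j i hj
      have hi' : 0 < (x i.rev : ℕ) := by omega
      simp only [hi', and_true, ite_eq_right_iff, one_ne_zero, imp_false] at this
      omega
    · push Not at h
      -- When all variables are `0`, every `u_j` realizes `⊥` and any index can be the exception; `0
      -- < n` supplies one.
      exact ⟨⟨0, hn⟩, us, fun j _ => hus j (by simp [h]), π', rfl⟩
  · rintro ⟨i, us, hus, π', rfl⟩
    refine ⟨fun j => if j.rev = i then 1 else 0, us, fun j hj => hus j ?_, π', ?_, rfl⟩
    · rintro rfl
      simp at hj
    · intro j k hjk
      by_cases h : j = i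
      · subst h
        simp [hjk.symm]
      · simp [h]

-- From `nondet n` to `|ℷ2| < 2^n`

/-- Each index `i` determines the family of bits `x i` for `x ∈ T`, and there are only `2 ^ T.card <
k` such families. -/
theorem pigeonhole_pairs {k n : ℕ} (hk : 2 ^ n ≤ k) (T : Finset (Fin k → Fin 2))
    (hT : T.card < n) : ∃ i j : Fin k, i ≠ j ∧ ∀ x ∈ T, x i = x j := by
  obtain ⟨i, j, hij, h⟩ := Fintype.exists_ne_map_eq_of_card_lt
    (fun (i : Fin k) (x : T) => x.1 i) (by
      simp only [Fintype.card_fun, Fintype.card_fin, Fintype.card_coe]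
      exact (Nat.pow_lt_pow_right (by norm_num) hT).trans_le hk)
  exact ⟨i, j, hij, fun x hx => congrFun h ⟨x, hx⟩⟩

theorem exists_distinctPairs_eq_cons {k : ℕ} (hk : 2 ≤ k) :
    ∃ a l, distinctPairs k = a :: l := by
  have : ((⟨0, by omega⟩, ⟨1, by omega⟩) : Fin k × Fin k) ∈ distinctPairs k := by
    simp [mem_distinctPairs]
  exact List.exists_cons_of_ne_nil (List.ne_nil_of_mem this)

/-- The falsity value of `x i = x j`. -/
def eqFalsity (P : Pole) {k : ℕ} (x : Fin k → Fin 2) (p : Fin k × Fin k) : Set Stack :=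
  ⋃ F : (Fin 1 → ℕ) → Set Stack, P.imp (F fun _ => x p.1) (F fun _ => x p.2)

theorem falsity_gimLt {P : Pole} {k : ℕ} {a : Fin k × Fin k} {l : List (Fin k × Fin k)}
    (h : distinctPairs k = a :: l) :
    Sentence.falsity P (gimLt k) = ⋃ x : Fin k → Fin 2, P.bigOr (eqFalsity P x) a l := by
  ext π
  rw [gimLt, BAFormula.mem_falsity_gim2_alls, Set.mem_iUnion, h]
  simp only [BAFormula.falsity_gim2_bigOr, BAFormula.gim2, Formula.falsity_eq, BATerm.toFTerm,
    bvar, FTerm.val]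
  constructor
  · rintro ⟨x, hx⟩
    exact ⟨fun i => x i.rev, hx⟩
  · rintro ⟨x, hx⟩
    refine ⟨fun i => x i.rev, ?_⟩
    simp only [Fin.rev_rev]
    exact hx

theorem idTerm_mem_dual_eqFalsity {P : Pole} {k : ℕ} {x : Fin k → Fin 2} {p : Fin k × Fin k}
    (h : x p.1 = x p.2) : idTerm ∈ P.dual (eqFalsity P x p) :=
  Pole.mem_dual_iUnion.2 fun F => idTerm_mem_dual (by rw [h])

theorem mem_dual_imp_of_eqFalsity {P : Pole} {k : ℕ} {x : Fin k → Fin 2} {p : Fin k × Fin k}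
    {t : Term} (ht : t ∈ P.dual (eqFalsity P x p)) (X : Set Stack) :
    t ∈ P.dual (P.imp X X) :=
  Pole.mem_dual_iUnion.1 ht fun _ => X

theorem mem_dual_imp_of_eqFalsity_of_ne {P : Pole} {k : ℕ} {x : Fin k → Fin 2}
    {p : Fin k × Fin k} {t : Term} (ht : t ∈ P.dual (eqFalsity P x p)) (h : x p.1 ≠ x p.2)
    (X : Set Stack) : t ∈ P.dual (P.imp ∅ X) := by
  have h' : ((x p.2 : ℕ)) ≠ x p.1 := fun e => h (Fin.ext e.symm)
  -- This predicate is `⊤` at the left value and `X` at the right one, so a realizer of a false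
  -- equation realizes `⊤ → X`.
  have := Pole.mem_dual_iUnion.1 ht fun v => if v 0 = x p.1 then ∅ else X
  simpa [h'] using this

/-- The term must not depend on `x`, so it is built for a whole set `T` of assignments, by strong
induction on its size; the free variable stands for the realizer of `nondet n`. -/
theorem exists_nondet_imp_gimLt_on {n k : ℕ} (hn : 0 < n) (hk : 2 ^ n ≤ k) {a : Fin k × Fin k}
    {l : List (Fin k × Fin k)} (hl : distinctPairs k = a :: l) (T : Finset (Fin k → Fin 2)) :
    ∃ t : LTerm 1, t.ProofLike ∧ ∀ (P : Pole) (θ : Term), θ ∈ P.dual (Sentence.falsity P (nondet n)) →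
      ∀ x ∈ T, subst (fun _ => θ) t ∈ P.dual (P.bigOr (eqFalsity P x) a l) := by
  induction hc : T.card using Nat.strong_induction_on generalizing T with
  | _ c ih =>
  subst hc
  rcases lt_or_ge T.card n with hT | hT
  · obtain ⟨i, j, hij, h⟩ := pigeonhole_pairs hk T hT
    obtain ⟨t, ht, hint⟩ := exists_bigOr_intro a l (i, j) (by
      rw [← hl, mem_distinctPairs]; exact hij)
    refine ⟨app (t.lift 1) (idTerm.lift 1),
      by simp [ProofLike, ht.lift, idTerm_proofLike.lift], fun P θ hθ x hx => ?_⟩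
    simp only [subst, subst_lift]
    exact Pole.app_mem_dual (hint P _) (idTerm_mem_dual_eqFalsity (h x hx))
  · obtain ⟨T', hT', hcard⟩ := Finset.exists_subset_card_eq hT
    let e : Fin n ≃ T' := (T'.equivFinOfCardEq hcard).symm
    have he : ∀ r, (e r : Fin k → Fin 2) ∈ T := fun r => hT' (e r).2
    choose f hf hfs using fun r : Fin n =>
      ih (T.erase (e r)).card (Finset.card_erase_lt_of_mem (he r)) (T.erase (e r)) rfl
    refine ⟨apps (var 0) (List.ofFn f), ProofLike.apps (by simp [ProofLike]) ?_,
      fun P θ hθ x hx π hπ => ?_⟩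
    · intro u hu
      obtain ⟨r, rfl⟩ := (List.mem_ofFn' f u).1 hu
      exact hf r
    · rw [subst_apps, List.map_ofFn]
      refine P.antiEval _ _ (eval_apps _ _ _) ?_
      simp only [subst]
      -- The term `f r` is only guaranteed on `T` without `e r`. The `e r` are distinct, so `x`
      -- spoils at most one argument, and `r₀` can be the position of the premise `⊤`.
      obtain ⟨r₀, hr₀⟩ : ∃ r₀ : Fin n, ∀ r, r ≠ r₀ → (e r : Fin k → Fin 2) ≠ x := by
        by_cases h : ∃ r₀ : Fin n, (e r₀ : Fin k → Fin 2) = x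
        · obtain ⟨r₀, rfl⟩ := h
          exact ⟨r₀, fun r hr h => hr (e.injective (Subtype.ext h))⟩
        · exact ⟨⟨0, hn⟩, fun r _ h' => h ⟨r, h'⟩⟩
      exact hθ _ (mem_falsity_nondet.2 ⟨_, r₀, _, fun r hr => hfs r P θ hθ x
        (Finset.mem_erase.2 ⟨(hr₀ r hr).symm, hx⟩), π, hπ, rfl⟩)

theorem realizes_imp_iff {P : Pole} {t : Term} {A B : Sentence} :
    Realizes P t (Formula.imp A B) ↔
      t ∈ P.dual (P.imp (Sentence.falsity P A) (Sentence.falsity P B)) := by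
  rw [Realizes, Sentence.falsity, Formula.falsity_imp]
  rfl

theorem exists_nondet_imp_gimLt {n : ℕ} (hn : 0 < n) : ∃ t : Term, t.ProofLike ∧
    RealizesUniversally t (Formula.imp (nondet n) (gimLt (2 ^ n))) := by
  obtain ⟨a, l, hl⟩ := exists_distinctPairs_eq_cons (Nat.le_self_pow hn.ne' 2)
  obtain ⟨t, ht, h⟩ := exists_nondet_imp_gimLt_on hn le_rfl hl Finset.univ
  refine ⟨lam t, by simpa [ProofLike] using ht, fun P => realizes_imp_iff.2 ?_⟩
  refine Pole.lam_closed_mem_dual fun θ hθ => ?_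
  rw [falsity_gimLt hl, Pole.mem_dual_iUnion]
  exact fun x => h P θ hθ x (Finset.mem_univ _)

-- From `|ℷ2| < 2^n` to `nondet n`

/-- Two distinct subsets of `Fin n` are separated by some `w p`. In the case of the pair `p`, the
realizer `v` of the equation is applied to `u_{w p}`. If `w p ≠ i`, then `u_{w p}` realizes `X` and
`v` realizes `X → X`; if `w p = i`, the equation is false and `v` accepts any argument. The term
never needs to know `i`. -/
theorem exists_gimLt_imp_nondet {n : ℕ} (hn : 0 < n) : ∃ t : Term, t.ProofLike ∧
    RealizesUniversally t (Formula.imp (gimLt (2 ^ n)) (nondet n)) := by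
  obtain ⟨a, l, hl⟩ := exists_distinctPairs_eq_cons (Nat.le_self_pow hn.ne' 2)
  let S : Fin (2 ^ n) ≃ Finset (Fin n) := Fintype.equivOfCardEq (by simp)
  have hS : ∀ p : Fin (2 ^ n) × Fin (2 ^ n), ∃ i : Fin n,
      p.1 ≠ p.2 → ¬ (i ∈ S p.1 ↔ i ∈ S p.2) := by
    intro p
    by_cases hp : p.1 = p.2
    · exact ⟨⟨0, hn⟩, fun h => (h hp).elim⟩
    · by_contra! h
      exact hp (S.injective (Finset.ext fun i => (h i).2))
  choose w hw using hS
  -- `Fin.last n` is the outermost variable, the realizer of the disjunction; `(w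
  -- p).rev.castSucc.succ` is `u_{w p}` seen under one more abstraction.
  obtain ⟨t, ht, h⟩ := exists_bigOr_elim a l (m := n + 1) (var (Fin.last n))
    (fun p => lam (app (var 0) (var (w p).rev.castSucc.succ)))
    (by simp [ProofLike]) (by simp [ProofLike])
  refine ⟨lams (n + 1) t, ht.lams, fun P => realizes_imp_iff.2 ?_⟩
  rintro _ ⟨g, hg, π, hπ, rfl⟩
  obtain ⟨X, i, us, hus, π, hX, rfl⟩ := mem_falsity_nondet.1 hπ
  have e := eval_lams t (Fin.cons g us : Fin (n + 1) → Term) π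
  rw [List.ofFn_succ] at e
  simp only [Fin.cons_zero, Fin.cons_succ] at e
  refine P.antiEval _ _ e ?_
  rw [falsity_gimLt hl, Pole.mem_dual_iUnion] at hg
  let x : Fin (2 ^ n) → Fin 2 := fun j => if i ∈ S j then 1 else 0
  refine h P (eqFalsity P x) X _ ?_ (fun p hp => ?_) π hX
  · simpa [subst] using hg x
  · refine Pole.lam_mem_dual fun v hv => ?_
    have hwp := hw p (by rwa [← hl, mem_distinctPairs] at hp)
    have hu : (Fin.cons g us : Fin (n + 1) → Term) (w p).rev.castSucc.rev = us (w p) := by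
      rw [Fin.rev_castSucc, Fin.rev_rev, Fin.cons_succ]
    simp only [subst, Fin.cons_zero, Fin.cons_succ, hu]
    by_cases hi : w p = i
    · refine Pole.app_mem_dual (mem_dual_imp_of_eqFalsity_of_ne hv ?_ X) (by simp [Pole.dual])
      rw [hi] at hwp
      by_cases h1 : i ∈ S p.1 <;> by_cases h2 : i ∈ S p.2 <;> simp_all [x]
    · exact Pole.app_mem_dual (mem_dual_imp_of_eqFalsity hv X) (hus _ hi)

-- Equivalence of `A_n` and `nondet n`

theorem falsity_boolNoDisjoint_subset {P : Pole} {n : ℕ} (hn : 0 < n) :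
    Sentence.falsity P (boolNoDisjoint n).gim2 ⊆ Sentence.falsity P (nondet n) := by
  intro π hπ
  obtain ⟨i, us, hus, π', rfl⟩ := (mem_falsity_boolNoDisjoint hn).1 hπ
  exact mem_falsity_nondet.2 ⟨Set.univ, i, us, hus, π', Set.mem_univ _, rfl⟩

theorem idTerm_realizes_nondet_imp {n : ℕ} (hn : 0 < n) :
    RealizesUniversally idTerm (Formula.imp (nondet n) (boolNoDisjoint n).gim2) := fun _ =>
  realizes_imp_iff.2 (idTerm_mem_dual (falsity_boolNoDisjoint_subset hn))

theorem ccTerm_proofLike (n : ℕ) : (ccTerm n).ProofLike := by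
  refine ProofLike.lams ?_
  simp only [ProofLike, true_and]
  refine ProofLike.apps (by simp [ProofLike]) fun u hu => ?_
  obtain ⟨i, -, rfl⟩ := List.mem_map.1 hu
  simp [ProofLike]

/-- With `k = k_π` and `π ∈ X`, the process `k_π u_j ⋆ ρ` evaluates to `u_j ⋆ π` for every stack
`ρ`; so `k_π u_j` realizes `⊥` whenever `u_j` realizes `X`. -/
theorem ccTerm_realizes_imp_nondet {n : ℕ} (hn : 0 < n) :
    RealizesUniversally (ccTerm n) (Formula.imp (boolNoDisjoint n).gim2 (nondet n)) := by
  refine fun P => realizes_imp_iff.2 ?_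
  rintro _ ⟨t, ht, π, hπ, rfl⟩
  obtain ⟨X, i, us, hus, π, hX, rfl⟩ := mem_falsity_nondet.1 hπ
  have e := eval_lams (app cc (lam (apps (var (Fin.last (n + 1)))
    ((List.finRange n).map fun i => app (var 0) (var i.rev.castSucc.succ)))))
    (Fin.cons t us : Fin (n + 1) → Term) π
  rw [List.ofFn_succ] at e
  simp only [Fin.cons_zero, Fin.cons_succ] at e
  refine P.antiEval _ _ e ?_
  simp only [subst]
  refine P.antiEval _ _ (.head (Step.push _ _ _) (.head (Step.save _ _)
    (.head (Step.grab _ _ _) .refl))) ?_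
  rw [inst_subst, subst_apps, ← List.ofFn_eq_map, List.map_ofFn]
  refine P.antiEval _ _ (eval_apps _ _ _) ?_
  have hl : (Fin.last (n + 1)) = (Fin.last n).succ := rfl
  simp only [subst, hl, Fin.cons_succ, Fin.rev_last, Fin.cons_zero]
  refine ht _ ((mem_falsity_boolNoDisjoint hn).2 ⟨i, _, fun j hj ρ _ => ?_, π, rfl⟩)
  have hu : (Fin.cons t us : Fin (n + 1) → Term) j.rev.castSucc.rev = us j := by
    rw [Fin.rev_castSucc, Fin.rev_rev, Fin.cons_succ]
  simp only [Function.comp_apply, subst, Fin.cons_zero, Fin.cons_succ, hu]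
  exact P.antiEval _ _ (.head (Step.push _ _ _) (.head (Step.restore _ _ _) .refl))
    (hus j hj π hX)

-- Assembling the universal equivalences

theorem universallyEquivalent_of_realizes {A B : Sentence} {t u : Term} (ht : t.ProofLike)
    (hu : u.ProofLike) (hAB : RealizesUniversally t (Formula.imp A B))
    (hBA : RealizesUniversally u (Formula.imp B A)) : UniversallyEquivalent A B := by
  refine ⟨lam (app (app (var 0) (t.lift 1)) (u.lift 1)),
    by simp [ProofLike, ht.lift, hu.lift], fun P => ?_⟩
  have e : Sentence.falsity P (Formula.close (Formula.iff A B)) =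
      ⋃ F : (Fin 0 → ℕ) → Set Stack, P.imp (P.imp (Sentence.falsity P (Formula.imp A B))
        (P.imp (Sentence.falsity P (Formula.imp B A)) (F ![]))) (F ![]) := by
    simp only [Formula.close, Formula.close₁, Formula.close₂, Formula.iff, Formula.and,
      Sentence.falsity, Formula.falsity.eq_6, Formula.falsity_imp, Formula.falsity_weaken]
    simp only [Formula.falsity, SOVal.cons]
    rw [Subsingleton.elim (fun i => FTerm.val Fin.elim0 (![] i)) ![]]
  rw [Realizes, e, Pole.mem_dual_iUnion]
  refine fun F => Pole.lam_closed_mem_dual fun z hz => ?_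
  simp only [subst, subst_lift]
  exact Pole.app_mem_dual (Pole.app_mem_dual hz (hAB P)) (hBA P)

theorem exists_realizes_imp_trans {A B C : Sentence}
    (hAB : ∃ t : Term, t.ProofLike ∧ RealizesUniversally t (Formula.imp A B))
    (hBC : ∃ t : Term, t.ProofLike ∧ RealizesUniversally t (Formula.imp B C)) :
    ∃ t : Term, t.ProofLike ∧ RealizesUniversally t (Formula.imp A C) := by
  obtain ⟨t, ht, h⟩ := hAB
  obtain ⟨u, hu, h'⟩ := hBC
  exact ⟨compTerm u t, compTerm_proofLike hu ht, fun P => realizes_imp_iff.2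
    (compTerm_mem_dual (realizes_imp_iff.1 (h' P)) (realizes_imp_iff.1 (h P)))⟩

end ClassicalRealizability


theorem mainTheorem5 (n : ℕ) (hn : 0 < n) :
    UniversallyEquivalent (gimLt (2 ^ n)) (boolNoDisjoint n).gim2 ∧
    UniversallyEquivalent (boolNoDisjoint n).gim2 (nondet n) ∧
    UniversallyEquivalent (gimLt (2 ^ n)) (nondet n) ∧
    (idTerm.ProofLike ∧
      RealizesUniversally idTerm (Formula.imp (nondet n) (boolNoDisjoint n).gim2)) ∧
    ((ccTerm n).ProofLike ∧
      RealizesUniversally (ccTerm n) (Formula.imp (boolNoDisjoint n).gim2 (nondet n))) := by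
  have hid := And.intro idTerm_proofLike (idTerm_realizes_nondet_imp hn)
  have hcc := And.intro (ccTerm_proofLike n) (ccTerm_realizes_imp_nondet hn)
  have hgn := exists_gimLt_imp_nondet hn
  have hng := exists_nondet_imp_gimLt hn
  obtain ⟨t, ht, h⟩ := exists_realizes_imp_trans hgn ⟨_, hid⟩
  obtain ⟨u, hu, h'⟩ := exists_realizes_imp_trans ⟨_, hcc⟩ hng
  obtain ⟨v, hv, hgn⟩ := hgn
  obtain ⟨w, hw, hng⟩ := hng
  exact ⟨universallyEquivalent_of_realizes ht hu h h',
    universallyEquivalent_of_realizes hcc.1 hid.1 hcc.2 hid.2,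
    universallyEquivalent_of_realizes hv hw hgn hng, hid, hcc⟩
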